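/- \textbf{Setting.} For $f:\mathbb R^d\to\mathbb R$ let $\delta f(x;h)=\lim_{s\to0+}\{f(x+sh)-f(x)\}/s$; $f$ is directionally differentiable if this limit exists and is finite for all $x,h$. Put $\Delta_f(\beta,\gamma)=f(\beta)-f(\gamma)-\delta f(\gamma;\beta-\gamma)$, $\bar\Delta_f(\beta,\gamma)=\frac12\{\Delta_f(\beta,\gamma)+\Delta_f(\gamma,\beta)\}$ and $D_2(\beta,\gamma)=\|\beta-\gamma\|_2^2/2$. A thresholding function is a real function $\Theta(t;\lambda)$, $t\in\mathbb R$, $\lambda\ge0$, which is odd and nondecreasing in $t$, tends to $\infty$ as $t\to\infty$, and satisfies $0\le\Theta(t;\lambda)\le t$ for $t\ge0$. Put $\Theta^{-1}(u;\lambda)=\sup\{t:\Theta(t;\lambda)\le u\}$, $\mathcal L_\Theta=1-\operatorname{ess\,inf}_{u\ge0}\mathrm d\Theta^{-1}(u;\lambda)/\mathrm du$, $P_\Theta(t;\lambda)=\int_0^{|t|}(\Theta^{-1}(u;\lambda)-u)\,\mathrm du$, and let $P_H(t;\lambda)=-t^2/2+\lambda|t|$ if $|t|<\lambda$, $P_H(t;\lambda)=\lambda^2/2$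 if $|t|\ge\lambda$; for vectors, $P_\Theta(\beta;\lambda)=\sum_jP_\Theta(\beta_j;\lambda)$ and likewise for $P_H$. Let $J(\beta)=\#\{j:\beta_j\ne0\}$. Let $p\ge1$, let $X\in\mathbb R^{n\times p}$ and $\beta^*\in\mathbb R^p$ be fixed, $J^*=J(\beta^*)$, and let $\varrho\ge\|X\|_2$. Let $l_0:\mathbb R^n\to\mathbb R$ be a random loss that is differentiable at $X\beta^*$ and such that $l(\beta)=l_0(X\beta)$ is directionally differentiable, and let $\psi:\mathbb R^p\to\mathbb R$ be a (possibly random) differentiable function. The effective noise $\epsilon=-\nabla l_0(X\beta^*)$ is assumed to be a mean-zero sub-Gaussian random vector with scale bounded by $\sigma>0$: every marginal $\langle\epsilon,a\rangle$ is sub-Gaussian with $\|\langle\epsilon,a\rangle\|_{\psi_2}\le\sigma\|a\|_2$, where $\|\xi\|_{\psi_2}=\inf\{s>0:\mathbb E\exp(\xi^2/s^2)\le2\}$ (the components of $\epsilon$ need not be independent). From an arbitrary starting point $\beta^{(0)}$ let $$\beta^{(t+1)}\in\arg\min_\beta\ l(\beta)+P_\Theta(\varrho\beta;\lambda)+\Delta_\psi(\beta,\beta^{(t)}),\qquad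 t\ge0 .$$ \textbf{Theorem.} There are universal constants $A_0,C,c>0$ such that the following holds for every $A\ge A_0$. Let $\delta,\varepsilon,\vartheta>0$, $K\ge0$, $\lambda=A\sigma\sqrt{\log(ep)}/\sqrt{(\delta\wedge\vartheta)\vartheta}$, $\kappa=1/(1+\varepsilon)$, and suppose that, almost surely, for all $\beta\in\mathbb R^p$, $$\varepsilon\Delta_\psi(\beta^*,\beta)+\delta D_2(X\beta,X\beta^*)+\vartheta P_H(\varrho(\beta-\beta^*);\lambda)+P_\Theta(\varrho\beta^*;\lambda)\le(2\bar\Delta_l-\varrho^2\mathcal L_\Theta D_2)(\beta,\beta^*)+P_\Theta(\varrho\beta;\lambda)+K\lambda^2J^*. \tag{S}$$ Then with probability at least $1-Cp^{-cA^2}$ the following hold simultaneously for all $t\ge1$, where $m_t=\min_{1\le s\le t}\Delta_\psi(\beta^{(s)},\beta^{(s-1)})$: \begin{enumerate} \item $\displaystyle\Delta_\psi(\beta^*,\beta^{(t)})\le\kappa^t\Delta_\psi(\beta^*,\beta^{(0)})+\frac{\kappa(1-\kappa^t)}{1-\kappa}\bigl(K\lambda^2J^*-m_t\bigr)$; \item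 if $m_t\le K\lambda^2J^*$, then $\displaystyle\Delta_\psi(\beta^*,\beta^{(t)})\le\kappa^t\Delta_\psi(\beta^*,\beta^{(0)})+\frac{\kappa}{1-\kappa}\bigl(K\lambda^2J^*-m_t\bigr)$; \item if $m_t\ge0$ (in particular if $\psi$ is convex), then $\displaystyle\Delta_\psi(\beta^*,\beta^{(t)})\le\kappa^t\Delta_\psi(\beta^*,\beta^{(0)})+\frac{\kappa}{1-\kappa}\,\frac{KA^2}{(\delta\wedge\vartheta)\vartheta}\,\sigma^2J^*\log(ep)$. \end{enumerate} -/

import Mathlib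

open MeasureTheory Filter Topology

noncomputable section

namespace BregmanSurrogate

/-- `ℝᵈ` with the Euclidean norm. -/
abbrev E (d : ℕ) : Type := EuclideanSpace ℝ (Fin d)

/-! One-sided directional derivatives and generalized Bregman functions -/

/-- The one-sided directional derivative of `ψ` at `x` with increment `h` exists, is finite, and
equals `d`. -/
def HasDirDeriv {d : ℕ} (ψ : E d → ℝ) (x h : E d) (v : ℝ) : Prop :=
  Tendsto (fun s : ℝ => (ψ (x + s • h) - ψ x) / s) (𝓝[>] 0) (𝓝 v)

/-- `ψ` is (one-sided) directionally differentiable on the whole space. -/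
def DirDifferentiable {d : ℕ} (ψ : E d → ℝ) : Prop :=
  ∀ x h : E d, ∃ v : ℝ, HasDirDeriv ψ x h v

/-- The one-sided directional derivative `δψ(x; h)` (the limit of the difference quotients as
`s → 0+`). -/
def dirDeriv {d : ℕ} (ψ : E d → ℝ) (x h : E d) : ℝ :=
  limUnder (𝓝[>] (0 : ℝ)) (fun s : ℝ => (ψ (x + s • h) - ψ x) / s)

/-- The generalized Bregman function
`Δ_ψ(β, γ) = ψ(β) - ψ(γ) - δψ(γ; β - γ)`. -/
def bregman {d : ℕ} (ψ : E d → ℝ) (β γ : E d) : ℝ :=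
  ψ β - ψ γ - dirDeriv ψ γ (β - γ)

/-- The symmetrized generalized Bregman function. -/
def symBregman {d : ℕ} (ψ : E d → ℝ) (β γ : E d) : ℝ :=
  (bregman ψ β γ + bregman ψ γ β) / 2

/-- `D₂(β, γ) = ‖β - γ‖₂² / 2`. -/
def D2 {d : ℕ} (β γ : E d) : ℝ := ‖β - γ‖ ^ 2 / 2

/-! Thresholding functions and the penalties they induce -/

/-- `Θ(t; λ)`, `t ∈ ℝ`, `λ ≥ 0`, is a thresholding function. -/
structure IsThresholding (Θ : ℝ → ℝ → ℝ) : Prop where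
  odd : ∀ lam, 0 ≤ lam → ∀ t, Θ (-t) lam = -Θ t lam
  mono : ∀ lam, 0 ≤ lam → ∀ t t', t ≤ t' → Θ t lam ≤ Θ t' lam
  tendsto : ∀ lam, 0 ≤ lam → Tendsto (fun t => Θ t lam) atTop atTop
  nonneg : ∀ lam, 0 ≤ lam → ∀ t, 0 ≤ t → 0 ≤ Θ t lam
  le_self : ∀ lam, 0 ≤ lam → ∀ t, 0 ≤ t → Θ t lam ≤ t

/-- `Θ⁻¹(u; λ) = sup {t : Θ(t; λ) ≤ u}` (only used for `u > 0`). -/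
def thresholdInv (Θ : ℝ → ℝ → ℝ) (u lam : ℝ) : ℝ := sSup {t : ℝ | Θ t lam ≤ u}

/-- The critical concavity number
`L_Θ = 1 - ess inf {dΘ⁻¹(u; λ)/du : u ≥ 0}`. The function `Θ⁻¹(·; λ)` is monotone, hence
differentiable almost everywhere. -/
def concavityNumber (Θ : ℝ → ℝ → ℝ) (lam : ℝ) : ℝ :=
  1 - essInf (fun u : ℝ => deriv (fun v : ℝ => thresholdInv Θ v lam) u)
    (volume.restrict (Set.Ici 0))

/-- The `Θ`-induced penalty `P_Θ(t; λ) = ∫₀^{|t|} (Θ⁻¹(u; λ) - u) du` of a real number. -/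
def penalty (Θ : ℝ → ℝ → ℝ) (lam t : ℝ) : ℝ :=
  ∫ u in (0 : ℝ)..|t|, (thresholdInv Θ u lam - u)

/-- `P_Θ(β; λ) = ∑ⱼ P_Θ(βⱼ; λ)`. -/
def penaltyVec {d : ℕ} (Θ : ℝ → ℝ → ℝ) (lam : ℝ) (β : E d) : ℝ :=
  ∑ j, penalty Θ lam (β j)

/-- The hard-thresholding penalty `P_H(t; λ)`: `-t²/2 + λ|t|` if `|t| < λ`, and `λ²/2` if
`|t| ≥ λ`. -/
def hardPenalty (lam t : ℝ) : ℝ :=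
  if |t| < lam then -t ^ 2 / 2 + lam * |t| else lam ^ 2 / 2

/-- `P_H(β; λ) = ∑ⱼ P_H(βⱼ; λ)`. -/
def hardPenaltyVec {d : ℕ} (lam : ℝ) (β : E d) : ℝ :=
  ∑ j, hardPenalty lam (β j)

/-- The support size `J(β) = ‖β‖₀`. -/
def suppSize {d : ℕ} (β : E d) : ℕ := {j | β j ≠ 0}.ncard

/-! Sub-Gaussian random variables and vectors -/

/-- Sub-Gaussian tails: `P(|ξ| ≥ t) ≤ C exp(-c t²)` for all `t > 0`, for some `C, c > 0`. -/
def IsSubGaussian {Ω : Type*} [MeasurableSpace Ω] (μ : Measure Ω) (ξ : Ω → ℝ) : Prop :=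
  ∃ C c : ℝ, 0 < C ∧ 0 < c ∧
    ∀ t : ℝ, 0 < t → μ.real {ω | t ≤ |ξ ω|} ≤ C * Real.exp (-c * t ^ 2)

/-- The `ψ₂`-norm `inf {s > 0 : E exp(ξ²/s²) ≤ 2}`; the expectation takes values in `[0, ∞]`. -/
def psi2Norm {Ω : Type*} [MeasurableSpace Ω] (μ : Measure Ω) (ξ : Ω → ℝ) : ℝ :=
  sInf {s : ℝ | 0 < s ∧ ∫⁻ ω, ENNReal.ofReal (Real.exp (ξ ω ^ 2 / s ^ 2)) ∂μ ≤ 2}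

/-- `ξ` is a sub-Gaussian random vector with scale bounded by `σ`: every marginal `⟨ξ, a⟩` is
sub-Gaussian with `ψ₂`-norm at most `σ ‖a‖₂`. -/
def IsSubGaussianVec {Ω : Type*} [MeasurableSpace Ω] (μ : Measure Ω) {d : ℕ}
    (ξ : Ω → E d) (σ : ℝ) : Prop :=
  AEMeasurable ξ μ ∧ ∀ a : E d,
    IsSubGaussian μ (fun ω => inner ℝ (ξ ω) a) ∧
    psi2Norm μ (fun ω => inner ℝ (ξ ω) a) ≤ σ * ‖a‖

/-! The composite sparse learning problem -/

/-- The map `β ↦ X β` between Euclidean spaces; its operator norm is the spectral norm of `X`. -/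
def design {n p : ℕ} (X : Matrix (Fin n) (Fin p) ℝ) : E p →L[ℝ] E n :=
  LinearMap.toContinuousLinearMap (Matrix.toEuclideanLin X)

/-- The loss on the coefficients, `l(β) = l₀(X β)`. -/
def loss {n p : ℕ} (l₀ : E n → ℝ) (X : Matrix (Fin n) (Fin p) ℝ) (β : E p) : ℝ :=
  l₀ (design X β)

/-- The effective noise `-∇l₀(X β⋆)`. -/
def effNoise {n p : ℕ} (l₀ : E n → ℝ) (X : Matrix (Fin n) (Fin p) ℝ) (βs : E p) : E n :=
  -gradient l₀ (design X βs)

/-- The surrogate `g(β; β⁻) = l(β) + P_Θ(ϱβ; λ) + Δ_ψ(β, β⁻)`. -/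
def surrogate {n p : ℕ} (l₀ : E n → ℝ) (X : Matrix (Fin n) (Fin p) ℝ) (Θ : ℝ → ℝ → ℝ)
    (rho lam : ℝ) (ψ : E p → ℝ) (β β' : E p) : ℝ :=
  loss l₀ X β + penaltyVec Θ lam (rho • β) + bregman ψ β β'

/-- `b 0, b 1, b 2, …` are iterates of the surrogate algorithm:
`b (t+1) ∈ arg min_β g(β; b t)`. -/
def IsIterates {n p : ℕ} (l₀ : E n → ℝ) (X : Matrix (Fin n) (Fin p) ℝ) (Θ : ℝ → ℝ → ℝ)
    (rho lam : ℝ) (ψ : E p → ℝ) (b : ℕ → E p) : Prop :=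
  ∀ t : ℕ, ∀ β : E p,
    surrogate l₀ X Θ rho lam ψ (b (t + 1)) (b t) ≤ surrogate l₀ X Θ rho lam ψ β (b t)

/-- The regularity condition: for all `β`,
`ε Δ_ψ(β⋆, β) + δ D₂(Xβ, Xβ⋆) + ϑ P_H(ϱ(β - β⋆); λ) + P_Θ(ϱβ⋆; λ)
  ≤ (2 Δ̄_l - ϱ² L_Θ D₂)(β, β⋆) + P_Θ(ϱβ; λ) + K λ² J(β⋆)`. -/
def RegularityS {n p : ℕ} (l₀ : E n → ℝ) (X : Matrix (Fin n) (Fin p) ℝ) (Θ : ℝ → ℝ → ℝ)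
    (rho lam : ℝ) (ψ : E p → ℝ) (βs : E p) (eps delta theta K : ℝ) : Prop :=
  ∀ β : E p,
    eps * bregman ψ βs β + delta * D2 (design X β) (design X βs)
        + theta * hardPenaltyVec lam (rho • (β - βs)) + penaltyVec Θ lam (rho • βs)
      ≤ (2 * symBregman (loss l₀ X) β βs - rho ^ 2 * concavityNumber Θ lam * D2 β βs)
        + penaltyVec Θ lam (rho • β) + K * lam ^ 2 * (suppSize βs : ℝ)

/-- `min_{1 ≤ s ≤ t} Δ_ψ(b s, b (s-1))`, for `t ≥ 1`. -/
def minStep {p : ℕ} (ψ : E p → ℝ) (b : ℕ → E p) (t : ℕ) (ht : 1 ≤ t) : ℝ :=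
  (Finset.Icc 1 t).inf' (Finset.nonempty_Icc.mpr ht) (fun s => bregman ψ (b s) (b (s - 1)))

end BregmanSurrogate

end

noncomputable section

namespace BregmanSurrogate

/-! Convexity of the penalty after adding the critical quadratic -/

/-! A deterministic one-step contraction is combined with one uniform bound on the noise.
Contraction: `P_Θ` plus `L_Θ` times the half square is convex, so first-order optimality of `b
(t+1)` towards `β⋆` holds with an error `ϱ² L_Θ D₂`. Adding (S) at `b (t+1)` and the three-point
identity for `Δ_ψ` cancels everything but the noise term `⟨ε, X(β - β⋆)⟩`. If `δ D₂ + ϑ P_H` absorbs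
it, then `(1+ε) Δ_ψ(β⋆, b (t+1)) ≤ Δ_ψ(β⋆, b t) + Kλ²J⋆ - Δ_ψ(b (t+1), b t)` (`bregman_step`), and
iterating gives the geometric bounds. Noise: with `a = δ ∧ ϑ`, the noise inequality need only be
checked where each coordinate is zero or at least `λ/ϱ` in modulus, since it is concave in between
(`noiseObjective_move_coordinate`). There `P_H` is `λ²/2` times the support size, and a net argument
with a union bound over supports suffices (`exists_event_inner_le`). The event does not depend on
the iterates, so all `t` are covered at once. -/

theorem convexOn_integral_abs {w : ℝ → ℝ} (hw : MonotoneOn w (Set.Ici 0)) (h0 : 0 ≤ w 0) :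
    ConvexOn ℝ Set.univ (fun t => ∫ u in (0 : ℝ)..|t|, w u) := by
  have hint : ∀ a b : ℝ, 0 ≤ a → 0 ≤ b → IntervalIntegrable w volume a b := by
    intro a b ha hb
    refine (hw.mono ?_).intervalIntegrable
    intro x hx
    exact le_trans (le_min ha hb) hx.1
  -- By monotonicity `w a` is a subgradient at `a` of the primitive of `w`, on either side of `a`.
  have hsub : ∀ a b : ℝ, 0 ≤ a → 0 ≤ b →
      w a * (b - a) ≤ (∫ u in (0 : ℝ)..b, w u) - ∫ u in (0 : ℝ)..a, w u := by
    intro a b ha hb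
    rw [intervalIntegral.integral_interval_sub_left (hint 0 b le_rfl hb) (hint 0 a le_rfl ha)]
    rcases le_total a b with hab | hab
    · have h1 := intervalIntegral.integral_mono_on (μ := volume) (f := fun _ => w a) (g := w) hab
        intervalIntegrable_const (hint a b ha hb)
        (fun x hx => hw ha (ha.trans hx.1) hx.1)
      rw [intervalIntegral.integral_const, smul_eq_mul] at h1
      linarith
    · have h1 := intervalIntegral.integral_mono_on (μ := volume) (f := w) (g := fun _ => w a) hab
        (hint b a hb ha) intervalIntegrable_const
        (fun x hx => hw (hb.trans hx.1) ha hx.2)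
      rw [intervalIntegral.integral_const, smul_eq_mul] at h1
      rw [intervalIntegral.integral_symm]
      linarith
  have hwnn : ∀ a, 0 ≤ a → 0 ≤ w a := fun a ha => h0.trans (hw Set.self_mem_Ici ha ha)
  refine ⟨convex_univ, fun x _ y _ a b ha hb hab => ?_⟩
  simp only [smul_eq_mul]
  set z := a * |x| + b * |y| with hz
  have hz0 : 0 ≤ z := by positivity
  have habs : |a * x + b * y| ≤ z := by
    refine (abs_add_le _ _).trans ?_
    rw [abs_mul, abs_mul, abs_of_nonneg ha, abs_of_nonneg hb]
  -- As `w ≥ 0`, the primitive increases, so `|a * x + b * y|` may be replaced by `z`; this is where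
  -- `h0` keeps the even extension convex at the origin.
  have hc0 := hsub _ z (abs_nonneg (a * x + b * y)) hz0
  have hc1 := mul_nonneg (hwnn _ (abs_nonneg (a * x + b * y))) (sub_nonneg.2 habs)
  have hx := mul_le_mul_of_nonneg_left (hsub z |x| hz0 (abs_nonneg x)) ha
  have hy := mul_le_mul_of_nonneg_left (hsub z |y| hz0 (abs_nonneg y)) hb
  have key : a * (w z * (|x| - z)) + b * (w z * (|y| - z)) = 0 := by
    have : a * (w z * (|x| - z)) + b * (w z * (|y| - z))
      = w z * ((a * |x| + b * |y|) - (a + b) * z) := by ring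
    rw [this, hab, ← hz]; ring
  have h3 : (a + b) * (∫ u in (0 : ℝ)..z, w u) = ∫ u in (0 : ℝ)..z, w u := by rw [hab, one_mul]
  linarith

section Threshold

variable {Θ : ℝ → ℝ → ℝ} (hΘ : IsThresholding Θ) {lam : ℝ} (hlam : 0 ≤ lam)

include hΘ hlam

theorem IsThresholding.mem_sublevel {u : ℝ} (hu : 0 ≤ u) : u ∈ {t : ℝ | Θ t lam ≤ u} :=
  hΘ.le_self lam hlam u hu

theorem IsThresholding.bddAbove_sublevel (u : ℝ) : BddAbove {t : ℝ | Θ t lam ≤ u} := by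
  obtain ⟨T, hT⟩ := ((hΘ.tendsto lam hlam).eventually (eventually_gt_atTop u)).exists
  refine ⟨T, fun t ht => ?_⟩
  by_contra hlt
  exact absurd (hΘ.mono lam hlam T t (not_le.1 hlt).le) (not_le.2 (lt_of_le_of_lt ht hT))

theorem IsThresholding.le_thresholdInv {u : ℝ} (hu : 0 ≤ u) : u ≤ thresholdInv Θ u lam :=
  le_csSup (hΘ.bddAbove_sublevel hlam u) (hΘ.mem_sublevel hlam hu)

theorem IsThresholding.monotoneOn_thresholdInv :
    MonotoneOn (fun u => thresholdInv Θ u lam) (Set.Ici 0) := fun u hu v _ huv =>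
  csSup_le_csSup (hΘ.bddAbove_sublevel hlam v) ⟨u, hΘ.mem_sublevel hlam hu⟩
    (fun _ ht => le_trans ht huv)

/-- A real-valued `essInf` is meaningful only for a function essentially bounded below; monotonicity
supplies the bound `0`. The endpoint, where the two-sided derivative is not controlled, is a null
set. -/
theorem IsThresholding.ae_le_deriv :
    ∀ᵐ u ∂(volume.restrict (Set.Ici (0 : ℝ))),
      1 - concavityNumber Θ lam ≤ deriv (fun v : ℝ => thresholdInv Θ v lam) u := by
  have hnn : ∀ᵐ u ∂(volume.restrict (Set.Ici (0 : ℝ))),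
      0 ≤ deriv (fun v : ℝ => thresholdInv Θ v lam) u := by
    rw [restrict_Ioi_eq_restrict_Ici.symm]
    filter_upwards [ae_restrict_mem measurableSet_Ioi] with u hu
    rw [← derivWithin_of_isOpen isOpen_Ioi hu]
    exact ((hΘ.monotoneOn_thresholdInv hlam).mono Set.Ioi_subset_Ici_self).derivWithin_nonneg
  have h := ae_essInf_le (μ := volume.restrict (Set.Ici (0 : ℝ)))
    (f := fun u : ℝ => deriv (fun v : ℝ => thresholdInv Θ v lam) u) ⟨0, by simpa using hnn⟩
  filter_upwards [h] with u hu
  rw [concavityNumber]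
  linarith

/-- A monotone function grows at least by the integral of its a.e. derivative; jumps and singular
parts only help, so no absolute continuity is needed. -/
theorem IsThresholding.monotoneOn_thresholdInv_sub :
    MonotoneOn (fun u => thresholdInv Θ u lam - (1 - concavityNumber Θ lam) * u)
      (Set.Ici 0) := by
  intro a ha b hb hab
  have hmono : MonotoneOn (fun u => thresholdInv Θ u lam) (Set.uIcc a b) :=
    (hΘ.monotoneOn_thresholdInv hlam).mono (fun x hx => by
      rw [Set.uIcc_of_le hab] at hx; exact le_trans ha hx.1)
  have h1 := hmono.intervalIntegral_deriv_mem_uIcc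
  have h2 : thresholdInv Θ a lam ≤ thresholdInv Θ b lam :=
    hΘ.monotoneOn_thresholdInv hlam ha hb hab
  rw [Set.uIcc_of_le (sub_nonneg.2 h2)] at h1
  have h3 : ∫ _ in a..b, (1 - concavityNumber Θ lam)
      ≤ ∫ x in a..b, deriv (fun u => thresholdInv Θ u lam) x := by
    refine intervalIntegral.integral_mono_ae_restrict hab intervalIntegrable_const
      hmono.intervalIntegrable_deriv ?_
    exact ae_restrict_of_ae_restrict_of_subset (fun x hx => le_trans ha hx.1)
      (hΘ.ae_le_deriv hlam)
  rw [intervalIntegral.integral_const, smul_eq_mul] at h3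
  have := h1.2
  simp only
  linarith

theorem IsThresholding.penalty_add_eq (t : ℝ) :
    penalty Θ lam t + concavityNumber Θ lam * (t ^ 2 / 2)
      = ∫ u in (0 : ℝ)..|t|, (thresholdInv Θ u lam - (1 - concavityNumber Θ lam) * u) := by
  have hint : IntervalIntegrable (fun u => thresholdInv Θ u lam) volume 0 |t| := by
    refine ((hΘ.monotoneOn_thresholdInv hlam).mono ?_).intervalIntegrable
    intro x hx
    exact le_trans (le_min le_rfl (abs_nonneg t)) hx.1
  rw [penalty, intervalIntegral.integral_sub hint (by simp),
    intervalIntegral.integral_sub hint (IntervalIntegrable.const_mul (by simp) _),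
    intervalIntegral.integral_const_mul, integral_id, sq_abs]
  ring

theorem IsThresholding.convexOn_penalty :
    ConvexOn ℝ Set.univ
      (fun t => penalty Θ lam t + concavityNumber Θ lam * (t ^ 2 / 2)) := by
  simp_rw [hΘ.penalty_add_eq hlam]
  refine convexOn_integral_abs (hΘ.monotoneOn_thresholdInv_sub hlam) ?_
  simpa using hΘ.le_thresholdInv hlam le_rfl

theorem IsThresholding.convexOn_penaltyVec {d : ℕ} :
    ConvexOn ℝ Set.univ
      (fun β : E d => penaltyVec Θ lam β + concavityNumber Θ lam * (‖β‖ ^ 2 / 2)) := by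
  refine ⟨convex_univ, fun x _ y _ a b ha hb hab => ?_⟩
  have hsum : ∀ β : E d, penaltyVec Θ lam β + concavityNumber Θ lam * (‖β‖ ^ 2 / 2)
      = ∑ j, (penalty Θ lam (β j) + concavityNumber Θ lam * (β j ^ 2 / 2)) := by
    intro β
    rw [EuclideanSpace.real_norm_sq_eq, Finset.sum_add_distrib, penaltyVec, ← Finset.mul_sum,
      Finset.sum_div]
  simp only [hsum, smul_eq_mul]
  rw [Finset.mul_sum, Finset.mul_sum, ← Finset.sum_add_distrib]
  refine Finset.sum_le_sum fun j _ => ?_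
  have := (hΘ.convexOn_penalty hlam).2 (Set.mem_univ (x j)) (Set.mem_univ (y j)) ha hb hab
  simpa [smul_eq_mul] using this

end Threshold

/-! One step of the algorithm -/

theorem HasDirDeriv.dirDeriv_eq {d : ℕ} {ψ : E d → ℝ} {x h : E d} {v : ℝ}
    (hv : HasDirDeriv ψ x h v) : dirDeriv ψ x h = v :=
  Tendsto.limUnder_eq hv

theorem hasDirDeriv_of_differentiableAt {d : ℕ} {ψ : E d → ℝ} {x : E d}
    (hψ : DifferentiableAt ℝ ψ x) (h : E d) : HasDirDeriv ψ x h (fderiv ℝ ψ x h) := by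
  have := (hψ.hasFDerivAt.hasLineDerivAt h).tendsto_slope_zero_right
  refine this.congr fun s => ?_
  rw [smul_eq_mul, div_eq_inv_mul]

theorem bregman_eq_fderiv {d : ℕ} {ψ : E d → ℝ} {γ : E d} (hψ : DifferentiableAt ℝ ψ γ)
    (β : E d) : bregman ψ β γ = ψ β - ψ γ - fderiv ℝ ψ γ (β - γ) := by
  rw [bregman, (hasDirDeriv_of_differentiableAt hψ _).dirDeriv_eq]

section Step

variable {n p : ℕ} {l₀ : E n → ℝ} {X : Matrix (Fin n) (Fin p) ℝ} {Θ : ℝ → ℝ → ℝ}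
  {rho lam : ℝ} {ψ : E p → ℝ}

/-- First-order optimality of a minimizer of the surrogate, towards an arbitrary point. -/
theorem surrogate_first_order (hΘ : IsThresholding Θ) (hlam : 0 ≤ lam)
    (hψ : Differentiable ℝ ψ) {b b' : E p}
    (hmin : ∀ β, surrogate l₀ X Θ rho lam ψ b b' ≤ surrogate l₀ X Θ rho lam ψ β b')
    (γ : E p) {v : ℝ} (hv : HasDirDeriv (loss l₀ X) b (γ - b) v) :
    0 ≤ v + (penaltyVec Θ lam (rho • γ) - penaltyVec Θ lam (rho • b))
      + rho ^ 2 * concavityNumber Θ lam * D2 b γ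
      + (fderiv ℝ ψ b (γ - b) - fderiv ℝ ψ b' (γ - b)) := by
  set h := γ - b with hh
  set L := concavityNumber Θ lam with hL
  have hψ' := hasDirDeriv_of_differentiableAt (hψ b) h
  have hquad : Tendsto (fun s : ℝ => inner ℝ b h + s * (‖h‖ ^ 2 / 2)) (𝓝[>] 0)
      (𝓝 (inner ℝ b h)) := by
    have : ContinuousAt (fun s : ℝ => inner ℝ b h + s * (‖h‖ ^ 2 / 2)) 0 := by fun_prop
    have h2 := this.tendsto.mono_left (nhdsWithin_le_nhds (s := Set.Ioi (0 : ℝ)))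
    simpa using h2
  have hlim := ((hv.add hψ').sub (hquad.const_mul (L * rho ^ 2))).add_const
    ((penaltyVec Θ lam (rho • γ) + L * (‖rho • γ‖ ^ 2 / 2)
      - (penaltyVec Θ lam (rho • b) + L * (‖rho • b‖ ^ 2 / 2))) - fderiv ℝ ψ b' h)
  have hnn : ∀ᶠ s in 𝓝[>] (0 : ℝ), 0 ≤
      (loss l₀ X (b + s • h) - loss l₀ X b) / s + (ψ (b + s • h) - ψ b) / s
        - L * rho ^ 2 * (inner ℝ b h + s * (‖h‖ ^ 2 / 2))
        + ((penaltyVec Θ lam (rho • γ) + L * (‖rho • γ‖ ^ 2 / 2)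
      - (penaltyVec Θ lam (rho • b) + L * (‖rho • b‖ ^ 2 / 2))) - fderiv ℝ ψ b' h) := by
    filter_upwards [Ioo_mem_nhdsGT (zero_lt_one' ℝ)] with s hs
    have h1 := hmin (b + s • h)
    simp only [surrogate] at h1
    rw [bregman_eq_fderiv (hψ b'), bregman_eq_fderiv (hψ b')] at h1
    have e1 : fderiv ℝ ψ b' (b + s • h - b') = fderiv ℝ ψ b' (b - b') + s * fderiv ℝ ψ b' h := by
      rw [show b + s • h - b' = (b - b') + s • h by abel, map_add, map_smul, smul_eq_mul]
    rw [e1] at h1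
    -- The chord inequality bounds the penalty increment, so the penalty itself is never
    -- differentiated.
    have hc := (hΘ.convexOn_penaltyVec hlam (d := p)).2 (Set.mem_univ (rho • b))
      (Set.mem_univ (rho • γ)) (sub_nonneg.2 hs.2.le) hs.1.le (by ring : (1 - s) + s = 1)
    have e2 : (1 - s) • rho • b + s • rho • γ = rho • (b + s • h) := by
      rw [hh]; module
    rw [e2] at hc
    simp only [smul_eq_mul, norm_smul, mul_pow, Real.norm_eq_abs, sq_abs, ← hL] at hc
    rw [norm_add_sq_real, inner_smul_right, norm_smul, Real.norm_eq_abs, abs_of_pos hs.1] at hc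
    simp only [norm_smul, mul_pow, Real.norm_eq_abs, sq_abs]
    have hs0 : s ≠ 0 := hs.1.ne'
    refine nonneg_of_mul_nonneg_right (a := s) ?_ hs.1
    have e3 : ∀ x y z w : ℝ, s * (x / s + y / s - z + w) = x + y - s * z + s * w := by
      intro x y z w; field_simp
    rw [e3]
    linarith
  have h0 := ge_of_tendsto hlim hnn
  have hn : ‖h‖ ^ 2 = ‖γ‖ ^ 2 - ‖b‖ ^ 2 - 2 * inner ℝ b h := by
    have := norm_add_sq_real b h
    rw [show b + h = γ by rw [hh]; abel] at this
    linarith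
  have hD : D2 b γ = ‖h‖ ^ 2 / 2 := by rw [D2, hh, norm_sub_rev]
  rw [hD, hn]
  simp only [norm_smul, mul_pow, Real.norm_eq_abs, sq_abs] at h0
  linarith

theorem dirDeriv_loss_eq {βs : E p} (hl : DifferentiableAt ℝ l₀ (design X βs)) (h : E p) :
    dirDeriv (loss l₀ X) βs h = - inner ℝ (effNoise l₀ X βs) (design X h) := by
  have h1 : HasFDerivAt (loss l₀ X) ((fderiv ℝ l₀ (design X βs)).comp (design X)) βs :=
    hl.hasFDerivAt.comp βs (design X).hasFDerivAt
  rw [(hasDirDeriv_of_differentiableAt h1.differentiableAt h).dirDeriv_eq, h1.fderiv, effNoise,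
    inner_neg_left, neg_neg, gradient, InnerProductSpace.toDual_symm_apply]
  rfl

theorem bregman_step (hΘ : IsThresholding Θ) (hlam : 0 ≤ lam)
    (hψ : Differentiable ℝ ψ) {βs : E p} {eps delta theta K : ℝ}
    (hl : DifferentiableAt ℝ l₀ (design X βs)) (hdir : DirDifferentiable (loss l₀ X))
    (hS : RegularityS l₀ X Θ rho lam ψ βs eps delta theta K)
    (hnoise : ∀ β : E p, inner ℝ (effNoise l₀ X βs) (design X β)
      ≤ delta * (‖design X β‖ ^ 2 / 2) + theta * hardPenaltyVec lam (rho • β))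
    {b b' : E p}
    (hmin : ∀ β, surrogate l₀ X Θ rho lam ψ b b' ≤ surrogate l₀ X Θ rho lam ψ β b') :
    (1 + eps) * bregman ψ βs b
      ≤ bregman ψ βs b' + (K * lam ^ 2 * (suppSize βs : ℝ) - bregman ψ b b') := by
  obtain ⟨v, hv⟩ := hdir b (βs - b)
  have h1 := surrogate_first_order hΘ hlam hψ hmin βs hv
  have h2 := hS b
  have h3 := hnoise (b - βs)
  have hsym : 2 * symBregman (loss l₀ X) b βs
      = inner ℝ (effNoise l₀ X βs) (design X (b - βs)) - v := by
    simp only [symBregman, bregman, hv.dirDeriv_eq, dirDeriv_loss_eq hl]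
    ring
  have hD : D2 (design X b) (design X βs) = ‖design X (b - βs)‖ ^ 2 / 2 := by
    rw [D2, map_sub]
  rw [hsym, hD] at h2
  -- These give `Δ_ψ(β⋆,b') - Δ_ψ(β⋆,b) - Δ_ψ(b,b') = ⟨∇ψ(b) - ∇ψ(b'), β⋆ - b⟩`.
  have e1 := bregman_eq_fderiv (hψ b') βs
  have e2 := bregman_eq_fderiv (hψ b) βs
  have e3 := bregman_eq_fderiv (hψ b') b
  have e4 : fderiv ℝ ψ b' (βs - b') = fderiv ℝ ψ b' (b - b') + fderiv ℝ ψ b' (βs - b) := by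
    rw [← map_add]; congr 1; abel
  linarith

end Step

/-- Only steps before `t` are assumed, because `M` will contain the minimum over the first `t` steps
and so depends on `t`. -/
theorem geometric_recursion {D : ℕ → ℝ} {κ M : ℝ} (hκ0 : 0 ≤ κ) (hκ1 : κ < 1) {t : ℕ}
    (h : ∀ s < t, D (s + 1) ≤ κ * (D s + M)) :
    D t ≤ κ ^ t * D 0 + κ * (1 - κ ^ t) / (1 - κ) * M := by
  induction t with
  | zero => simp
  | succ t ih =>
    have h1 := h t (Nat.lt_succ_self t)
    have h2 := mul_le_mul_of_nonneg_left (ih fun s hs => h s (hs.trans (Nat.lt_succ_self t))) hκ0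
    have hk : 1 - κ ≠ 0 := by linarith
    have e : κ * (κ ^ t * D 0 + κ * (1 - κ ^ t) / (1 - κ) * M) + κ * M
        = κ ^ (t + 1) * D 0 + κ * (1 - κ ^ (t + 1)) / (1 - κ) * M := by
      field_simp; ring
    linarith

/-! Reduction of the hard-thresholding penalty to a multiple of the support size -/

theorem hardPenalty_zero {lam : ℝ} (hlam : 0 < lam) : hardPenalty lam 0 = 0 := by
  simp [hardPenalty, hlam]

theorem hardPenalty_of_le {lam t : ℝ} (h : lam ≤ |t|) : hardPenalty lam t = lam ^ 2 / 2 := by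
  simp [hardPenalty, not_lt.2 h]

theorem hardPenaltyVec_eq_suppSize {p : ℕ} {lam rho : ℝ} (hlam : 0 < lam) {β : E p}
    (h : ∀ j, β j = 0 ∨ lam ≤ |rho * β j|) :
    hardPenaltyVec lam (rho • β) = lam ^ 2 / 2 * (suppSize β : ℝ) := by
  classical
  have h1 : ∀ j, hardPenalty lam ((rho • β) j) = if β j ≠ 0 then lam ^ 2 / 2 else 0 := by
    intro j
    rw [PiLp.smul_apply, smul_eq_mul]
    by_cases h0 : β j = 0
    · simp [h0, hardPenalty_zero hlam]
    · rw [if_pos h0, hardPenalty_of_le ((h j).resolve_left h0)]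
  simp_rw [hardPenaltyVec, h1]
  rw [← Finset.sum_filter, Finset.sum_const, nsmul_eq_mul, mul_comm, suppSize,
    Set.ncard_eq_toFinset_card']
  simp

/-- The quadratic-plus-hard-penalty objective of the stochastic bound. -/
def noiseObjective {n p : ℕ} (T : E p →L[ℝ] E n) (e : E n) (a theta rho lam : ℝ) (β : E p) : ℝ :=
  a * (‖T β‖ ^ 2 / 2) + theta * hardPenaltyVec lam (rho • β) - inner ℝ e (T β)

section Reduction

variable {n p : ℕ} {T : E p →L[ℝ] E n} {e : E n} {a theta rho lam : ℝ}

/-- Between `0` and `±λ/ϱ` the objective is quadratic in one coordinate with second derivative `a‖T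
u‖² - ϑϱ² ≤ 0`. Being concave, it is no larger at one of the two endpoints. -/
theorem noiseObjective_move_coordinate (hrho : 0 < rho) (hT : ‖T‖ ≤ rho) (hlam : 0 < lam)
    (ha : 0 ≤ a) (hat : a ≤ theta) (β : E p) (j : Fin p) (hj : |rho * β j| < lam) :
    ∃ γ : E p, noiseObjective T e a theta rho lam γ ≤ noiseObjective T e a theta rho lam β ∧
      (∀ i, i ≠ j → γ i = β i) ∧ (γ j = 0 ∨ lam ≤ |rho * γ j|) := by
  classical
  set u : E p := EuclideanSpace.single j (1 : ℝ) with hu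
  obtain ⟨r, τ, hr, hτ0, hτ1, hx⟩ : ∃ r τ : ℝ, |rho * r| = lam ∧ 0 ≤ τ ∧ τ ≤ 1 ∧
      β j = τ * r := by
    have hab : |rho * β j| / lam ≤ 1 := (div_le_one hlam).2 hj.le
    rw [abs_mul, abs_of_pos hrho] at hab
    rcases le_total 0 (β j) with h | h
    · refine ⟨lam / rho, rho * |β j| / lam, ?_, by positivity, hab, ?_⟩
      · rw [mul_div_cancel₀ _ hrho.ne', abs_of_pos hlam]
      · rw [abs_of_nonneg h]; field_simp
    · refine ⟨-(lam / rho), rho * |β j| / lam, ?_, by positivity, hab, ?_⟩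
      · rw [mul_neg, mul_div_cancel₀ _ hrho.ne', abs_neg, abs_of_pos hlam]
      · rw [abs_of_nonpos h]; field_simp
  set β0 : E p := β - (β j) • u with hβ0
  set β1 : E p := β0 + r • u with hβ1
  have hβ : β = β0 + (τ * r) • u := by rw [hβ0, hx]; abel
  have c0 : ∀ i, i ≠ j → β0 i = β i := fun i hi => by simp [hβ0, hu, hi]
  have c0j : β0 j = 0 := by simp [hβ0, hu]
  have c1 : ∀ i, i ≠ j → β1 i = β i := fun i hi => by simp [hβ1, c0 i hi, hu, hi]
  have c1j : β1 j = r := by simp [hβ1, c0j, hu]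
  have hP : ∀ γ : E p, (∀ i, i ≠ j → γ i = β i) → hardPenaltyVec lam (rho • γ)
      = hardPenalty lam (rho * γ j)
        + ∑ i ∈ Finset.univ.erase j, hardPenalty lam (rho * β i) := by
    intro γ hγ
    rw [hardPenaltyVec, ← Finset.add_sum_erase _ _ (Finset.mem_univ j)]
    congr 1
    refine Finset.sum_congr rfl fun i hi => ?_
    rw [PiLp.smul_apply, hγ i (Finset.ne_of_mem_erase hi), smul_eq_mul]
  have hPβ : hardPenalty lam (rho * β j) = τ * (lam ^ 2 / 2) + τ * (1 - τ) * (lam ^ 2 / 2) := by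
    rw [hardPenalty, if_pos hj, hx]
    have e1 : |rho * (τ * r)| = τ * lam := by
      rw [show rho * (τ * r) = τ * (rho * r) by ring, abs_mul, hr, abs_of_nonneg hτ0]
    rw [← sq_abs, e1]; ring
  have hTu : ‖r • T u‖ ≤ lam := by
    have : ‖T u‖ ≤ rho := by
      refine (T.le_opNorm u).trans ?_
      simpa [hu] using hT
    rw [norm_smul, Real.norm_eq_abs, ← hr, abs_mul, abs_of_pos hrho, mul_comm]
    exact mul_le_mul_of_nonneg_right this (abs_nonneg r)
  have hTsq : a * ‖r • T u‖ ^ 2 ≤ theta * lam ^ 2 :=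
    mul_le_mul hat (pow_le_pow_left₀ (norm_nonneg _) hTu 2) (by positivity) (ha.trans hat)
  have eT1 : T β1 = T β0 + r • T u := by rw [hβ1, map_add, map_smul]
  have eT : T β = T β0 + τ • (r • T u) := by
    rw [hβ, map_add, map_smul, mul_smul]
  -- The concavity gap is exactly `τ(1-τ)(ϑλ² - a‖r • T u‖²)/2`.
  have key : (1 - τ) * noiseObjective T e a theta rho lam β0
      + τ * noiseObjective T e a theta rho lam β1 ≤ noiseObjective T e a theta rho lam β := by
    have hnn : 0 ≤ τ * (1 - τ) * (theta * lam ^ 2 - a * ‖r • T u‖ ^ 2) :=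
      mul_nonneg (mul_nonneg hτ0 (sub_nonneg.2 hτ1)) (sub_nonneg.2 hTsq)
    simp only [noiseObjective]
    rw [hP β0 c0, hP β1 c1, hP β (fun _ _ => rfl), hPβ, c0j, c1j, mul_zero,
      hardPenalty_zero hlam, hardPenalty_of_le hr.ge, eT1, eT, norm_add_sq_real,
      norm_add_sq_real, inner_add_right, inner_add_right, inner_smul_right _ (r • T u) τ,
      inner_smul_right _ (r • T u) τ, norm_smul τ, mul_pow, Real.norm_eq_abs, sq_abs]
    linarith
  by_cases hle : noiseObjective T e a theta rho lam β0 ≤ noiseObjective T e a theta rho lam β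
  · exact ⟨β0, hle, c0, Or.inl c0j⟩
  · refine ⟨β1, ?_, c1, Or.inr (by rw [c1j, hr])⟩
    by_contra hlt
    push Not at hle hlt
    rcases hτ0.eq_or_lt with h | h
    · rw [← h] at key; linarith
    · have h1 := mul_lt_mul_of_pos_left hlt h
      have h2 := mul_le_mul_of_nonneg_left hle.le (sub_nonneg.2 hτ1)
      linarith

theorem exists_noiseObjective_le (hrho : 0 < rho) (hT : ‖T‖ ≤ rho) (hlam : 0 < lam)
    (ha : 0 ≤ a) (hat : a ≤ theta) (β : E p) (S : Finset (Fin p)) :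
    ∃ γ : E p, noiseObjective T e a theta rho lam γ ≤ noiseObjective T e a theta rho lam β ∧
      ∀ j ∈ S, γ j = 0 ∨ lam ≤ |rho * γ j| := by
  classical
  induction S using Finset.induction_on with
  | empty => exact ⟨β, le_rfl, by simp⟩
  | insert j S hj ih =>
    obtain ⟨γ, hγ, hS⟩ := ih
    by_cases hg : lam ≤ |rho * γ j|
    · refine ⟨γ, hγ, fun i hi => ?_⟩
      rcases Finset.mem_insert.1 hi with rfl | hi
      · exact Or.inr hg
      · exact hS i hi
    · obtain ⟨γ', h1, h2, h3⟩ :=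
        noiseObjective_move_coordinate (e := e) hrho hT hlam ha hat γ j (not_le.1 hg)
      refine ⟨γ', h1.trans hγ, fun i hi => ?_⟩
      rcases Finset.mem_insert.1 hi with rfl | hi
      · exact h3
      · rw [h2 i (fun h => hj (h ▸ hi))]
        exact hS i hi

/-- A bound on the noise in terms of the support size gives the same bound in terms of the
hard-thresholding penalty. -/
theorem inner_le_of_suppSize_bound (hT : ‖T‖ ≤ rho) (hlam : 0 < lam)
    (ha : 0 ≤ a) (hat : a ≤ theta)
    (h : ∀ β : E p, inner ℝ e (T β)
      ≤ a * (‖T β‖ ^ 2 / 2) + theta * (lam ^ 2 / 2 * (suppSize β : ℝ))) (β : E p) :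
    inner ℝ e (T β) ≤ a * (‖T β‖ ^ 2 / 2) + theta * hardPenaltyVec lam (rho • β) := by
  rcases ((norm_nonneg T).trans hT).eq_or_lt with h0 | hrho
  -- For `ϱ = 0` no rescaling is possible, but `T` vanishes and both sides are zero.
  · have hT0 : T = 0 := by rw [← norm_le_zero_iff, h0]; exact hT
    have hz : hardPenaltyVec lam (rho • β) = 0 := by
      rw [← h0, zero_smul]
      simp [hardPenaltyVec, hardPenalty_zero hlam]
    simp [hT0, hz]
  · obtain ⟨γ, h1, h2⟩ :=
      exists_noiseObjective_le (e := e) hrho hT hlam ha hat β Finset.univ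
    have h3 := h γ
    rw [← hardPenaltyVec_eq_suppSize hlam (fun j => h2 j (Finset.mem_univ j))] at h3
    simp only [noiseObjective] at h1
    linarith

end Reduction

/-! Half-nets of unit balls -/

/-- A 1-separated set of maximal cardinality in the ball of radius 2, scaled by one half: the
packing bound gives `5 ^ dim`, maximality gives the covering. -/
theorem exists_half_net (F : Type*) [NormedAddCommGroup F] [NormedSpace ℝ F]
    [FiniteDimensional ℝ F] :
    ∃ N : Finset F, N.card ≤ 5 ^ Module.finrank ℝ F ∧ (∀ v ∈ N, ‖v‖ ≤ 1) ∧
      ∀ u : F, ‖u‖ ≤ 1 → ∃ v ∈ N, ‖u - v‖ ≤ 1 / 2 := by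
  classical
  let Q : Finset F → Prop := fun s =>
    (∀ c ∈ s, ‖c‖ ≤ 2) ∧ ∀ c ∈ s, ∀ d ∈ s, c ≠ d → 1 ≤ ‖c - d‖
  let K : Set ℕ := {k | ∃ s, Q s ∧ s.card = k}
  have hbd : BddAbove K :=
    ⟨5 ^ Module.finrank ℝ F, by
      rintro _ ⟨s, hs, rfl⟩; exact Besicovitch.card_le_of_separated s hs.1 hs.2⟩
  obtain ⟨s, hs, hcard⟩ := Nat.sSup_mem (s := K) ⟨0, ∅, ⟨by simp, by simp⟩, rfl⟩ hbd
  refine ⟨s.image (fun v => (1 / 2 : ℝ) • v), ?_, ?_, ?_⟩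
  · exact Finset.card_image_le.trans (Besicovitch.card_le_of_separated s hs.1 hs.2)
  · intro v hv
    obtain ⟨c, hc, rfl⟩ := Finset.mem_image.1 hv
    rw [norm_smul]
    have := hs.1 c hc
    norm_num
    linarith
  · intro u hu
    by_contra hcon
    push Not at hcon
    have hfar : ∀ c ∈ s, 1 < ‖(2 : ℝ) • u - c‖ := by
      intro c hc
      have h1 := hcon _ (Finset.mem_image_of_mem _ hc)
      have e1 : (2 : ℝ) • u - c = (2 : ℝ) • (u - (1 / 2 : ℝ) • c) := by module
      rw [e1, norm_smul]
      norm_num at h1 ⊢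
      linarith
    have hnot : (2 : ℝ) • u ∉ s := fun hmem => by
      have := hfar _ hmem
      simp at this
      linarith
    have hQ : Q (insert ((2 : ℝ) • u) s) := by
      refine ⟨fun c hc => ?_, fun c hc d hd hcd => ?_⟩
      · rcases Finset.mem_insert.1 hc with rfl | hc
        · rw [norm_smul]; norm_num; exact hu
        · exact hs.1 c hc
      · rcases Finset.mem_insert.1 hc with rfl | hc' <;>
          rcases Finset.mem_insert.1 hd with rfl | hd'
        · exact absurd rfl hcd
        · exact (hfar d hd').le
        · rw [norm_sub_rev]; exact (hfar c hc').le
        · exact hs.2 c hc' d hd' hcd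
    have := le_csSup hbd ⟨_, hQ, rfl⟩
    rw [Finset.card_insert_of_notMem hnot, ← hcard] at this
    omega

/-- A finite set of test vectors in the unit ball that controls linear functionals on a
subspace. -/
theorem exists_test_vectors {n : ℕ} (V : Submodule ℝ (E n)) :
    ∃ N : Finset (E n), N.card ≤ 5 ^ Module.finrank ℝ V ∧ (∀ v ∈ N, ‖v‖ ≤ 1) ∧
      ∀ (e : E n) (r : ℝ), 0 ≤ r → (∀ v ∈ N, inner ℝ e v ≤ r) →
        ∀ w ∈ V, inner ℝ e w ≤ 2 * r * ‖w‖ := by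
  classical
  obtain ⟨N, h1, h2, h3⟩ := exists_half_net V
  refine ⟨N.image (fun v : V => (v : E n)), Finset.card_image_le.trans h1, ?_, ?_⟩
  · intro v hv
    obtain ⟨c, hc, rfl⟩ := Finset.mem_image.1 hv
    exact h2 c hc
  -- On `V` the functional is the inner product with the projection `g`. A net point `v` near
  -- `g/‖g‖` gives `‖g‖ ≤ r + ‖g‖/2`.
  · intro e r hr he w hw
    set g : V := V.orthogonalProjectionOnto e with hg
    have hin : ∀ v : V, inner ℝ e (v : E n) = inner ℝ g v := by
      intro v
      rw [hg, ← Submodule.inner_orthogonalProjectionOnto_eq_of_mem_right]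
    have hM : ‖g‖ ≤ 2 * r := by
      rcases eq_or_ne g 0 with h0 | h0
      · rw [h0, norm_zero]; positivity
      · have hgn : 0 < ‖g‖ := norm_pos_iff.2 h0
        obtain ⟨v, hv, hvu⟩ := h3 (‖g‖⁻¹ • g) (by
          rw [norm_smul, norm_inv, norm_norm, inv_mul_cancel₀ hgn.ne'])
        have e1 : inner ℝ g (‖g‖⁻¹ • g) = ‖g‖ := by
          change inner ℝ (g : E n) (‖g‖⁻¹ • (g : E n)) = ‖g‖
          rw [real_inner_smul_right, real_inner_self_eq_norm_sq, Submodule.coe_norm]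
          field_simp
        have e2 : inner ℝ g v ≤ r := by
          rw [← hin]; exact he _ (Finset.mem_image_of_mem _ hv)
        have e3 : inner ℝ g (‖g‖⁻¹ • g - v) ≤ ‖g‖ * (1 / 2) :=
          (real_inner_le_norm _ _).trans (mul_le_mul_of_nonneg_left hvu (norm_nonneg _))
        rw [inner_sub_right, e1] at e3
        linarith
    have := hin ⟨w, hw⟩
    simp only at this
    rw [this]
    exact (real_inner_le_norm _ _).trans (mul_le_mul_of_nonneg_right hM (norm_nonneg _))

/-! Sub-Gaussian tails and the uniform stochastic bound -/

section SubGaussian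

variable {Ω : Type*} [MeasurableSpace Ω] {μ : Measure Ω} [IsProbabilityMeasure μ] {ξ : Ω → ℝ}

theorem IsSubGaussian.exists_lintegral_exp_sq_ne_top (hm : AEMeasurable ξ μ)
    (h : IsSubGaussian μ ξ) :
    ∃ η : ℝ, 0 < η ∧ ∫⁻ ω, ENNReal.ofReal (Real.exp (η * ξ ω ^ 2)) ∂μ ≠ ⊤ := by
  obtain ⟨C, c, hC, hc, htail⟩ := h
  refine ⟨c / 4, by positivity, ?_⟩
  let A : ℕ → Set Ω := fun k => {ω | (k : ℝ) ≤ |ξ ω|}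
  have hA : ∀ k, NullMeasurableSet (A k) μ := fun k =>
    nullMeasurableSet_le aemeasurable_const hm.abs
  let w : ℕ → ℝ := fun k => Real.exp (c / 4 * ((k : ℝ) + 1) ^ 2)
  have hpt : ∀ ω, ENNReal.ofReal (Real.exp (c / 4 * ξ ω ^ 2))
      ≤ ∑' k, (A k).indicator (fun _ => ENNReal.ofReal (w k)) ω := by
    intro ω
    refine le_trans ?_ (ENNReal.le_tsum ⌊|ξ ω|⌋₊)
    have hmem : ω ∈ A ⌊|ξ ω|⌋₊ := Nat.floor_le (abs_nonneg (ξ ω))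
    rw [Set.indicator_of_mem hmem]
    refine ENNReal.ofReal_le_ofReal (Real.exp_le_exp.2 ?_)
    rw [← sq_abs (ξ ω)]
    have := (Nat.lt_floor_add_one |ξ ω|).le
    gcongr
  -- The tail bound is unavailable at level `0`; there `max 1 C` falls back on total mass one.
  have hmeas : ∀ k, μ (A k) ≤ ENNReal.ofReal (max 1 C * Real.exp (-c * (k : ℝ) ^ 2)) := by
    intro k
    rw [← ofReal_measureReal]
    refine ENNReal.ofReal_le_ofReal ?_
    rcases Nat.eq_zero_or_pos k with rfl | hk
    · simp
    · exact (htail k (by exact_mod_cast hk)).trans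
        (mul_le_mul_of_nonneg_right (le_max_right _ _) (Real.exp_nonneg _))
  have hterm : ∀ k : ℕ, ENNReal.ofReal (w k) * μ (A k)
      ≤ ENNReal.ofReal (max 1 C * Real.exp (c / 2) * Real.exp (-(c / 2)) ^ k) := by
    intro k
    refine (mul_le_mul_right (hmeas k) _).trans ?_
    rw [← ENNReal.ofReal_mul (Real.exp_nonneg _)]
    refine ENNReal.ofReal_le_ofReal ?_
    have hk : (k : ℝ) ≤ (k : ℝ) ^ 2 := by exact_mod_cast Nat.le_self_pow two_ne_zero k
    have h1 : w k * Real.exp (-c * (k : ℝ) ^ 2)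
        ≤ Real.exp (c / 2) * Real.exp (-(c / 2)) ^ k := by
      rw [← Real.exp_nat_mul, ← Real.exp_add, ← Real.exp_add]
      refine Real.exp_le_exp.2 ?_
      nlinarith [mul_nonneg hc.le (sq_nonneg ((k : ℝ) - 1)), mul_le_mul_of_nonneg_left hk hc.le]
    have := mul_le_mul_of_nonneg_left h1 (zero_le_one.trans (le_max_left 1 C))
    linarith
  refine ne_top_of_le_ne_top ?_ (lintegral_mono hpt)
  rw [lintegral_tsum fun k => aemeasurable_const.indicator₀ (hA k)]
  simp_rw [lintegral_indicator_const₀ (hA _)]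
  refine ne_top_of_le_ne_top ?_ (ENNReal.tsum_le_tsum hterm)
  refine Summable.tsum_ofReal_ne_top (Summable.mul_left _ ?_)
  exact summable_geometric_of_lt_one (Real.exp_nonneg _) (by
    rw [Real.exp_lt_one_iff]; linarith)

/-- Rules out an infimum over the empty set, which would make `psi2Norm` zero without content. As
the scale grows, the integral tends to `1 < 2` by dominated convergence. -/
theorem IsSubGaussian.exists_lintegral_exp_sq_le_two (hm : AEMeasurable ξ μ)
    (h : IsSubGaussian μ ξ) :
    ∃ s : ℝ, 0 < s ∧ ∫⁻ ω, ENNReal.ofReal (Real.exp (ξ ω ^ 2 / s ^ 2)) ∂μ ≤ 2 := by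
  obtain ⟨η, hη, hfin⟩ := h.exists_lintegral_exp_sq_ne_top hm
  have hlim : Tendsto (fun k : ℕ => ∫⁻ ω, ENNReal.ofReal
      (Real.exp (ξ ω ^ 2 / (((k : ℝ) + 1) / √η) ^ 2)) ∂μ) atTop (𝓝 (∫⁻ _, 1 ∂μ)) := by
    refine tendsto_lintegral_of_dominated_convergence' _ (fun k => ?_) (fun k => ?_) hfin ?_
    · fun_prop
    · refine Eventually.of_forall fun ω => ENNReal.ofReal_le_ofReal (Real.exp_le_exp.2 ?_)
      rw [div_pow, Real.sq_sqrt hη.le, div_div_eq_mul_div, mul_comm η]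
      refine div_le_self (by positivity) (one_le_pow₀ ?_)
      linarith [Nat.cast_nonneg (α := ℝ) k]
    · refine Eventually.of_forall fun ω => ?_
      have h1 : Tendsto (fun k : ℕ => (((k : ℝ) + 1) / √η) ^ 2) atTop atTop := by
        refine (tendsto_pow_atTop two_ne_zero).comp ?_
        exact Tendsto.atTop_div_const (Real.sqrt_pos.2 hη)
          (tendsto_atTop_add_const_right _ _ tendsto_natCast_atTop_atTop)
      have h2 := (h1.const_div_atTop (ξ ω ^ 2)).rexp
      have h3 := ENNReal.tendsto_ofReal h2
      simpa using h3
  rw [lintegral_one, measure_univ] at hlim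
  obtain ⟨k, hk⟩ := (hlim.eventually (gt_mem_nhds ENNReal.one_lt_two)).exists
  exact ⟨((k : ℝ) + 1) / √η, by positivity, hk.le⟩

/-- Markov's inequality at an admissible scale below `s`; the strict inequality avoids asking
whether the infimum is attained. -/
theorem measureReal_le_of_psi2Norm_lt (hm : AEMeasurable ξ μ) (h : IsSubGaussian μ ξ) {s : ℝ}
    (hs : psi2Norm μ ξ < s) {t : ℝ} (ht : 0 ≤ t) :
    μ.real {ω | t ≤ ξ ω} ≤ 2 * Real.exp (-(t ^ 2 / s ^ 2)) := by
  obtain ⟨s', ⟨hs'0, hint⟩, hs's⟩ := exists_lt_of_csInf_lt (h.exists_lintegral_exp_sq_le_two hm) hs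
  have h1 : μ {ω | t ≤ ξ ω} ≤ ENNReal.ofReal (2 * Real.exp (-(t ^ 2 / s' ^ 2))) := by
    calc μ {ω | t ≤ ξ ω}
        ≤ μ {ω | ENNReal.ofReal (Real.exp (t ^ 2 / s' ^ 2))
            ≤ ENNReal.ofReal (Real.exp (ξ ω ^ 2 / s' ^ 2))} := by
          refine measure_mono fun ω hω => ?_
          have h2 : t ≤ ξ ω := hω
          refine ENNReal.ofReal_le_ofReal (Real.exp_le_exp.2 ?_)
          gcongr
      _ ≤ (∫⁻ ω, ENNReal.ofReal (Real.exp (ξ ω ^ 2 / s' ^ 2)) ∂μ)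
            / ENNReal.ofReal (Real.exp (t ^ 2 / s' ^ 2)) := by
          refine meas_ge_le_lintegral_div (by fun_prop) ?_ ENNReal.ofReal_ne_top
          exact (ENNReal.ofReal_pos.2 (Real.exp_pos _)).ne'
      _ ≤ 2 / ENNReal.ofReal (Real.exp (t ^ 2 / s' ^ 2)) := by gcongr
      _ = ENNReal.ofReal (2 * Real.exp (-(t ^ 2 / s' ^ 2))) := by
          rw [Real.exp_neg, ← div_eq_mul_inv, ENNReal.ofReal_div_of_pos (Real.exp_pos _)]
          simp
  have h2 : μ.real {ω | t ≤ ξ ω} ≤ 2 * Real.exp (-(t ^ 2 / s' ^ 2)) :=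
    ENNReal.toReal_le_of_le_ofReal (by positivity) h1
  refine h2.trans ?_
  gcongr

end SubGaussian

/-! ### Union bound over supports -/

theorem apply_mem_span_of_support {n p : ℕ} (T : E p →L[ℝ] E n) (β : E p) (J : Finset (Fin p))
    (hJ : ∀ j, β j ≠ 0 → j ∈ J) :
    T β ∈ Submodule.span ℝ
      ((J.image fun j => T (EuclideanSpace.single j (1 : ℝ)) : Finset (E n)) : Set (E n)) := by
  classical
  have hβ : β = ∑ j, β j • EuclideanSpace.single j (1 : ℝ) := by
    ext i
    simp [Finset.sum_apply, Pi.single_apply]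
  rw [hβ, map_sum]
  refine Submodule.sum_mem _ fun j _ => ?_
  rw [map_smul]
  by_cases h : β j = 0
  · rw [h, zero_smul]; exact Submodule.zero_mem _
  · exact Submodule.smul_mem _ _
      (Submodule.subset_span (Finset.mem_coe.2 (Finset.mem_image_of_mem _ (hJ j h))))

theorem exists_event_inner_le {Ω : Type*} [MeasurableSpace Ω] {μ : Measure Ω}
    [IsProbabilityMeasure μ] {n p : ℕ} (T : E p →L[ℝ] E n) {ξ : Ω → E n} {σ : ℝ} (hσ : 0 < σ)
    (hξ : IsSubGaussianVec μ ξ σ) {r : ℝ} (hr : 0 ≤ r) :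
    ∃ B : Set Ω, μ.real B ≤ 2 * ((1 + 5 * Real.exp (-(r ^ 2 / (2 * σ) ^ 2))) ^ p - 1) ∧
      ∀ ω ∉ B, ∀ β : E p,
        inner ℝ (ξ ω) (T β) ≤ 2 * (r * √(suppSize β : ℝ)) * ‖T β‖ := by
  classical
  let V : Finset (Fin p) → Submodule ℝ (E n) := fun J => Submodule.span ℝ
    ((J.image fun j => T (EuclideanSpace.single j (1 : ℝ)) : Finset (E n)) : Set (E n))
  have hV : ∀ J, Module.finrank ℝ (V J) ≤ J.card := fun J =>
    (finrank_span_finset_le_card _).trans Finset.card_image_le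
  choose N hN1 hN2 hN3 using fun J => exists_test_vectors (V J)
  -- The empty support is trivial; omitting it produces the `- 1` that makes the bound small.
  let I : Finset (Finset (Fin p)) := Finset.univ.erase ∅
  let bad : Finset (Fin p) → E n → Set Ω := fun J v => {ω | r * √(J.card : ℝ) ≤ inner ℝ (ξ ω) v}
  refine ⟨⋃ J ∈ I, ⋃ v ∈ N J, bad J v, ?_, ?_⟩
  · set x := Real.exp (-(r ^ 2 / (2 * σ) ^ 2)) with hx
    have hbad : ∀ J, ∀ v ∈ N J, μ.real (bad J v) ≤ 2 * x ^ J.card := by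
      intro J v hv
      -- Doubling `σ` buys the strict inequality.
      have hlt : psi2Norm μ (fun ω => inner ℝ (ξ ω) v) < 2 * σ := by
        refine (hξ.2 v).2.trans_lt ?_
        have := mul_le_mul_of_nonneg_left (hN2 J v hv) hσ.le
        linarith
      refine (measureReal_le_of_psi2Norm_lt (hξ.1.inner_const) (hξ.2 v).1 hlt
        (by positivity)).trans (le_of_eq ?_)
      rw [hx, ← Real.exp_nat_mul, mul_pow, Real.sq_sqrt (Nat.cast_nonneg _)]
      congr 2
      ring
    have hJ : ∀ J, μ.real (⋃ v ∈ N J, bad J v) ≤ 2 * (5 * x) ^ J.card := by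
      intro J
      calc μ.real (⋃ v ∈ N J, bad J v) ≤ ∑ v ∈ N J, μ.real (bad J v) :=
            measureReal_biUnion_finset_le _ _
        _ ≤ ∑ _v ∈ N J, 2 * x ^ J.card := Finset.sum_le_sum (hbad J)
        _ = (N J).card * (2 * x ^ J.card) := by rw [Finset.sum_const, nsmul_eq_mul]
        _ ≤ (5 : ℝ) ^ J.card * (2 * x ^ J.card) := by
            refine mul_le_mul_of_nonneg_right ?_ (by positivity)
            exact_mod_cast (hN1 J).trans (Nat.pow_le_pow_right (by norm_num) (hV J))
        _ = 2 * (5 * x) ^ J.card := by rw [mul_pow]; ring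
    calc μ.real (⋃ J ∈ I, ⋃ v ∈ N J, bad J v) ≤ ∑ J ∈ I, μ.real (⋃ v ∈ N J, bad J v) :=
          measureReal_biUnion_finset_le _ _
      _ ≤ ∑ J ∈ I, 2 * (5 * x) ^ J.card := Finset.sum_le_sum fun J _ => hJ J
      _ = 2 * ((1 + 5 * x) ^ p - 1) := by
          have h1 := Finset.sum_pow_mul_eq_add_pow (5 * x) 1 (Finset.univ : Finset (Fin p))
          simp only [one_pow, mul_one, Finset.powerset_univ, Finset.card_univ,
            Fintype.card_fin] at h1
          rw [← Finset.add_sum_erase _ _ (Finset.mem_univ ∅)] at h1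
          rw [← Finset.mul_sum, add_comm 1, ← h1]
          simp [I]
  · intro ω hω β
    simp only [Set.mem_iUnion, not_exists] at hω
    set J : Finset (Fin p) := Finset.univ.filter fun j => β j ≠ 0 with hJ
    have hcard : suppSize β = J.card := by
      rw [suppSize, Set.ncard_eq_toFinset_card', hJ]
      simp
    have hmem : T β ∈ V J := apply_mem_span_of_support T β J (by simp [hJ])
    rcases eq_or_ne J ∅ with h0 | h0
    · have : β = 0 := by
        ext j
        by_contra hj
        have : j ∈ J := by simpa [hJ] using hj
        simp [h0] at this
      simp [this]
    · rw [hcard]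
      refine hN3 J (ξ ω) (r * √(J.card : ℝ)) (by positivity) (fun v hv => ?_) _ hmem
      have := hω J (by simp [I, h0]) v hv
      exact (not_le.1 this).le

/-- Half of the exponent `A²/16` absorbs the factor `p`, as `A² ≥ 64`. Then `5px ≤ 1`, and `exp y -
1 ≤ 2y` yields `2 · 2 · 5 = 20`. -/
theorem union_bound_le_rpow {p : ℕ} (hp : 1 ≤ p) {A : ℝ} (hA : 8 ≤ A) :
    2 * ((1 + 5 * Real.exp (-(A ^ 2 * Real.log (Real.exp 1 * p) / 16))) ^ p - 1)
      ≤ 20 * (p : ℝ) ^ (-(1 / 32 * A ^ 2)) := by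
  have hp0 : (0 : ℝ) < p := by exact_mod_cast hp
  have hl : 0 ≤ Real.log p := Real.log_nonneg (by exact_mod_cast hp)
  rw [Real.log_mul (Real.exp_pos 1).ne' hp0.ne', Real.log_exp]
  set x := Real.exp (-(A ^ 2 * (1 + Real.log p) / 16)) with hx
  have hA2 : 64 ≤ A ^ 2 := by nlinarith
  have hxp : p * x ≤ Real.exp (-(1 / 32 * A ^ 2 * (1 + Real.log p))) := by
    rw [hx]
    nth_rw 1 [← Real.exp_log hp0]
    rw [← Real.exp_add]
    refine Real.exp_le_exp.2 ?_
    nlinarith [mul_nonneg (sub_nonneg.2 hA2) hl]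
  have h5 : p * (5 * x) ≤ 1 := by
    have h1 : Real.exp (-(1 / 32 * A ^ 2 * (1 + Real.log p))) ≤ Real.exp (-2) := by
      refine Real.exp_le_exp.2 ?_
      nlinarith [mul_nonneg (sq_nonneg A) hl]
    have h2 : Real.exp (-2) * 5 ≤ 1 := by
      rw [Real.exp_neg, inv_mul_le_iff₀ (Real.exp_pos 2), mul_one]
      have h3 := Real.exp_one_gt_d9
      have h4 : Real.exp 2 = Real.exp 1 * Real.exp 1 := by rw [← Real.exp_add]; norm_num
      nlinarith
    linarith
  have hpow : (1 + 5 * x) ^ p ≤ Real.exp (p * (5 * x)) := by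
    rw [Real.exp_nat_mul]
    refine pow_le_pow_left₀ (by positivity) ?_ p
    linarith [Real.add_one_le_exp (5 * x)]
  have hnn : 0 ≤ p * (5 * x) := by positivity
  have hexp := (le_abs_self _).trans
    (Real.abs_exp_sub_one_le (x := p * (5 * x)) (by rwa [abs_of_nonneg hnn]))
  rw [abs_of_nonneg hnn] at hexp
  have hfin : Real.exp (-(1 / 32 * A ^ 2 * (1 + Real.log p)))
      ≤ (p : ℝ) ^ (-(1 / 32 * A ^ 2)) := by
    rw [Real.rpow_def_of_pos hp0]
    refine Real.exp_le_exp.2 ?_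
    nlinarith [sq_nonneg A]
  linarith

/-! ### Assembly of the convergence bounds -/

/-- The bounds of the convergence theorem, for one realization on which each step contracts. -/
theorem bregman_bounds_of_step {p : ℕ} {ψ : E p → ℝ} {βs : E p} {b : ℕ → E p}
    {eps κ M : ℝ} (heps : 0 < eps) (hκ : κ = 1 / (1 + eps)) (hM : 0 ≤ M)
    (hstep : ∀ s, (1 + eps) * bregman ψ βs (b (s + 1))
      ≤ bregman ψ βs (b s) + (M - bregman ψ (b (s + 1)) (b s))) (t : ℕ) (ht : 1 ≤ t) :
    bregman ψ βs (b t) ≤ κ ^ t * bregman ψ βs (b 0)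
        + κ * (1 - κ ^ t) / (1 - κ) * (M - minStep ψ b t ht) ∧
      (minStep ψ b t ht ≤ M → bregman ψ βs (b t) ≤ κ ^ t * bregman ψ βs (b 0)
        + κ / (1 - κ) * (M - minStep ψ b t ht)) ∧
      (0 ≤ minStep ψ b t ht → bregman ψ βs (b t) ≤ κ ^ t * bregman ψ βs (b 0)
        + κ / (1 - κ) * M) := by
  have hκ0 : 0 < κ := by rw [hκ]; positivity
  have hκ1 : κ < 1 := by rw [hκ, div_lt_one (by positivity)]; linarith
  have h1 : bregman ψ βs (b t) ≤ κ ^ t * bregman ψ βs (b 0)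
      + κ * (1 - κ ^ t) / (1 - κ) * (M - minStep ψ b t ht) := by
    refine geometric_recursion (D := fun s => bregman ψ βs (b s)) hκ0.le hκ1 fun s hs => ?_
    have hm : minStep ψ b t ht ≤ bregman ψ (b (s + 1)) (b s) :=
      Finset.inf'_le (fun s => bregman ψ (b s) (b (s - 1)))
        (Finset.mem_Icc.2 ⟨Nat.le_add_left 1 s, hs⟩)
    have h2 := hstep s
    rw [hκ, one_div, ← div_eq_inv_mul, le_div_iff₀ (by positivity)]
    linarith
  have hc : 0 ≤ κ / (1 - κ) := div_nonneg hκ0.le (by linarith)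
  have hcoef : κ * (1 - κ ^ t) / (1 - κ) = κ / (1 - κ) * (1 - κ ^ t) := by ring
  have hpow0 : 0 ≤ κ ^ t := by positivity
  have hpow1 : κ ^ t ≤ 1 := pow_le_one₀ hκ0.le hκ1.le
  rw [hcoef, mul_assoc] at h1
  refine ⟨by rwa [hcoef, mul_assoc], fun hm => h1.trans ?_, fun hm => h1.trans ?_⟩
  · have := mul_nonneg hpow0 (sub_nonneg.2 hm)
    gcongr
    linarith
  -- The slack `M - (1 - κ^t)(M - m)` equals `κ^t M + (1 - κ^t) m`.
  · have e1 := mul_nonneg hpow0 hM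
    have e2 := mul_nonneg (sub_nonneg.2 hpow1) hm
    gcongr
    linarith

end BregmanSurrogate
end

theorem theorem6 :
    ∃ A₀ C c : ℝ, 0 < A₀ ∧ 0 < C ∧ 0 < c ∧
      ∀ (Ω : Type*) [MeasurableSpace Ω] (μ : Measure Ω) [IsProbabilityMeasure μ]
        (n p : ℕ) (_ : 1 ≤ p)
        (X : Matrix (Fin n) (Fin p) ℝ) (rho : ℝ) (_ : ‖BregmanSurrogate.design X‖ ≤ rho)
        (Θ : ℝ → ℝ → ℝ) (_ : BregmanSurrogate.IsThresholding Θ)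
        (βs : BregmanSurrogate.E p)
        -- the (random) loss and auxiliary function
        (l₀ : Ω → BregmanSurrogate.E n → ℝ) (ψ : Ω → BregmanSurrogate.E p → ℝ)
        (_ : ∀ᵐ ω ∂μ, BregmanSurrogate.DirDifferentiable (BregmanSurrogate.loss (l₀ ω) X))
        (_ : ∀ᵐ ω ∂μ, DifferentiableAt ℝ (l₀ ω) (BregmanSurrogate.design X βs))
        (_ : ∀ᵐ ω ∂μ, Differentiable ℝ (ψ ω))
        -- the effective noise is centred and sub-Gaussian with scale at most σ
        (σ : ℝ) (_ : 0 < σ)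
        (_ : BregmanSurrogate.IsSubGaussianVec μ
          (fun ω => BregmanSurrogate.effNoise (l₀ ω) X βs) σ)
        (_ : ∫ ω, BregmanSurrogate.effNoise (l₀ ω) X βs ∂μ = 0)
        (eps delta theta K A lam κ : ℝ)
        (_ : 0 < eps) (_ : 0 < delta) (_ : 0 < theta) (_ : 0 ≤ K) (_ : A₀ ≤ A)
        (_ : lam = A * σ * √(Real.log (Real.exp 1 * p)) / √(min delta theta * theta))
        (_ : κ = 1 / (1 + eps))
        (_ : ∀ᵐ ω ∂μ, BregmanSurrogate.RegularityS (l₀ ω) X Θ rho lam (ψ ω) βs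
          eps delta theta K)
        -- the iterates, with an arbitrary (possibly random) starting point `b ω 0`
        (b : Ω → ℕ → BregmanSurrogate.E p)
        (_ : ∀ᵐ ω ∂μ, BregmanSurrogate.IsIterates (l₀ ω) X Θ rho lam (ψ ω) (b ω)),
        ∃ G : Set Ω, MeasurableSet G ∧ 1 - C * (p : ℝ) ^ (-(c * A ^ 2)) ≤ μ.real G ∧
          ∀ ω ∈ G, ∀ (t : ℕ) (ht : 1 ≤ t),
            -- the bound with the exact geometric sum
            BregmanSurrogate.bregman (ψ ω) βs (b ω t)
                ≤ κ ^ t * BregmanSurrogate.bregman (ψ ω) βs (b ω 0)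
                  + κ * (1 - κ ^ t) / (1 - κ) *
                    (K * lam ^ 2 * (BregmanSurrogate.suppSize βs : ℝ)
                      - BregmanSurrogate.minStep (ψ ω) (b ω) t ht) ∧
            -- the bound with the full geometric series, when the bracket is nonnegative
            (BregmanSurrogate.minStep (ψ ω) (b ω) t ht
                ≤ K * lam ^ 2 * (BregmanSurrogate.suppSize βs : ℝ) →
              BregmanSurrogate.bregman (ψ ω) βs (b ω t)
                ≤ κ ^ t * BregmanSurrogate.bregman (ψ ω) βs (b ω 0)
                  + κ / (1 - κ) *
                    (K * lam ^ 2 * (BregmanSurrogate.suppSize βs : ℝ)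
                      - BregmanSurrogate.minStep (ψ ω) (b ω) t ht)) ∧
            -- geometric contraction to the order `σ² J⋆ log(ep)`
            (0 ≤ BregmanSurrogate.minStep (ψ ω) (b ω) t ht →
              BregmanSurrogate.bregman (ψ ω) βs (b ω t)
                ≤ κ ^ t * BregmanSurrogate.bregman (ψ ω) βs (b ω 0)
                  + κ / (1 - κ) * (K * A ^ 2 / (min delta theta * theta)) *
                    (σ ^ 2 * (BregmanSurrogate.suppSize βs : ℝ)
                      * Real.log (Real.exp 1 * p))) := by
  refine ⟨8, 20, 1 / 32, by norm_num, by norm_num, by norm_num, ?_⟩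
  intro Ω _ μ _ n p hp X rho hX Θ hΘ βs l₀ ψ hdir hdiff hψ σ hσ hnoise _ eps delta theta K A lam κ
    heps hdelta htheta hK hA hlam hκ hS b hb
  have hp1 : (1 : ℝ) ≤ p := by exact_mod_cast hp
  have hp0 : (0 : ℝ) < p := by linarith
  set ℓ := Real.log (Real.exp 1 * p) with hℓ
  have hℓ1 : 1 ≤ ℓ := by
    rw [hℓ, Real.log_mul (Real.exp_pos 1).ne' hp0.ne', Real.log_exp]
    linarith [Real.log_nonneg hp1]
  set a := min delta theta with ha
  have ha0 : 0 < a := lt_min hdelta htheta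
  have hA0 : 0 < A := by linarith
  have hlam0 : 0 < lam := by rw [hlam]; positivity
  have hlamsq : lam ^ 2 = A ^ 2 * σ ^ 2 * ℓ / (a * theta) := by
    rw [hlam, div_pow, mul_pow, mul_pow, Real.sq_sqrt (by positivity), Real.sq_sqrt (by positivity)]
  -- Chosen so that `2r²/a = ϑλ²/2`, which the square below turns into the penalty on the support
  -- size.
  set r := A * σ * √ℓ / 2 with hr
  have hrsq : r ^ 2 = A ^ 2 * σ ^ 2 * ℓ / 4 := by
    rw [hr, div_pow, mul_pow, mul_pow, Real.sq_sqrt (by positivity)]; norm_num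
  obtain ⟨B, hB, hgood⟩ := BregmanSurrogate.exists_event_inner_le
    (BregmanSurrogate.design X) hσ hnoise (r := r) (by positivity)
  have hBp : μ.real B ≤ 20 * (p : ℝ) ^ (-(1 / 32 * A ^ 2)) := by
    refine hB.trans (le_of_eq_of_le ?_ (BregmanSurrogate.union_bound_le_rpow hp hA))
    have : r ^ 2 / (2 * σ) ^ 2 = A ^ 2 * ℓ / 16 := by
      rw [hrsq]; field_simp; norm_num
    rw [this]
  have hall := hdir.and (hdiff.and (hψ.and (hS.and hb)))
  set N : Set Ω := {ω | ¬ (BregmanSurrogate.DirDifferentiable (BregmanSurrogate.loss (l₀ ω) X) ∧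
    DifferentiableAt ℝ (l₀ ω) (BregmanSurrogate.design X βs) ∧ Differentiable ℝ (ψ ω) ∧
    BregmanSurrogate.RegularityS (l₀ ω) X Θ rho lam (ψ ω) βs eps delta theta K ∧
    BregmanSurrogate.IsIterates (l₀ ω) X Θ rho lam (ψ ω) (b ω))} with hN
  have hN0 : μ N = 0 := hall
  -- The exceptional sets need not be measurable; the measurable hull has the same measure.
  refine ⟨(toMeasurable μ (B ∪ N))ᶜ, (measurableSet_toMeasurable _ _).compl, ?_, ?_⟩
  · rw [probReal_compl_eq_one_sub (measurableSet_toMeasurable _ _)]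
    have h1 : μ.real (toMeasurable μ (B ∪ N)) = μ.real B := by
      rw [measureReal_def, measure_toMeasurable, measure_congr (union_ae_eq_left_of_ae_eq_empty
        (ae_eq_empty.2 hN0)), measureReal_def]
    rw [h1]
    linarith
  · intro ω hω t ht
    have hω' : ω ∉ B ∪ N := fun h => hω (subset_toMeasurable _ _ h)
    have hωB : ω ∉ B := fun h => hω' (Or.inl h)
    obtain ⟨hdir', hdiff', hψ', hS', hb'⟩ := not_not.1 fun h => hω' (Or.inr h)
    have hbound := BregmanSurrogate.inner_le_of_suppSize_bound
      (e := BregmanSurrogate.effNoise (l₀ ω) X βs) hX hlam0 ha0.le (min_le_right delta theta)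
      (fun β => by
        refine (hgood ω hωB β).trans ?_
        set k : ℝ := (BregmanSurrogate.suppSize β : ℝ)
        have hk : √k ^ 2 = k := Real.sq_sqrt (Nat.cast_nonneg _)
        set y := ‖BregmanSurrogate.design X β‖
        refine le_of_mul_le_mul_left ?_ ha0
        have e1 : a * (theta * (lam ^ 2 / 2 * k)) = 2 * r ^ 2 * √k ^ 2 := by
          rw [hlamsq, hrsq, hk]; field_simp; ring
        rw [mul_add, e1]
        nlinarith [sq_nonneg (a * y - 2 * r * √k)])
    have hstep : ∀ s, (1 + eps) * BregmanSurrogate.bregman (ψ ω) βs (b ω (s + 1))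
        ≤ BregmanSurrogate.bregman (ψ ω) βs (b ω s)
          + (K * lam ^ 2 * (BregmanSurrogate.suppSize βs : ℝ)
            - BregmanSurrogate.bregman (ψ ω) (b ω (s + 1)) (b ω s)) := fun s =>
      BregmanSurrogate.bregman_step hΘ hlam0.le hψ' hdiff' hdir' hS'
        (fun β => (hbound β).trans (by gcongr; exact min_le_left _ _)) (hb' s)
    have hfin := BregmanSurrogate.bregman_bounds_of_step heps hκ (by positivity) hstep t ht
    refine ⟨hfin.1, hfin.2.1, fun hm => (hfin.2.2 hm).trans (le_of_eq ?_)⟩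
    rw [hlamsq]
    ring
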